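/- Units are such that $[\hat x_i,\hat p_j]=i\delta_{ij}$ and $\hat a_i=(\hat x_i+i\hat p_i)/\sqrt2$. A covariance matrix (CM) of finitely many bosonic modes (with vanishing first moments) is a real symmetric matrix $\sigma$ with $\sigma+\tfrac i2\Omega\ge 0$, where $\Omega$ is the symplectic form; its asymmetry matrix is the complex symmetric matrix $A_{ij}=\langle\hat a_j\hat a_i\rangle$. All modes have the same frequency. A Gaussian thermal operation (GTO) with $k\ge 0$ bath modes acts on CMs by adjoining $k$ modes with thermal CM $\nu\mathbb 1$ (where $\nu>1/2$ is the quadrature variance at the background temperature), applying $\sigma\mapsto S\sigma S^T$ with $S$ symplectic and orthogonal on all modes together, and tracing out the $k$ bath modes; $k=0$ means that no bath is used. For complex symmetric matrices we write $A\to A'$ under a GTO if that GTO takes the states with asymmetry matrix $A$ to states with asymmetry matrix $A'$. A weak catalytic transformation from $A$ to $A'$ with $m$ catalyst modes and $k$ bath modes is possible if there are an $m\times m$ complex symmetric matrix $A_C$ and a matrix $A'_{SC}$ on system and catalyst such that $A\oplus A_C\to A'_{SC}$ under some GTO with $k$ bath modes, where the system block of $A'_{SC}$ is $A'$ and its catalyst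 block is $A_C$ (the off-diagonal blocks are arbitrary). **Theorem.** Let $n\ge1$, let $A,A'$ be complex symmetric $n\times n$ matrices, and let $\alpha_1\ge\dots\ge\alpha_n$ and $\alpha'_1\ge\dots\ge\alpha'_n$ be their singular values. A weak catalytic transformation from $A$ to $A'$, with some finite number of catalyst modes, is possible without a thermal bath if and only if $\boldsymbol\alpha'\prec_w\boldsymbol\alpha$, that is, $$\sum_{i=1}^{k}\alpha'_i\le\sum_{i=1}^{k}\alpha_i\qquad\text{for all }k=1,\dots,n,$$ and it is possible with a thermal bath (of some finite number of modes) if and only if the same condition holds. Whenever it is possible, it can be done with $2n-1$ catalyst modes and no bath, and it can also be done with $n$ catalyst modes together with $n-1$ bath modes. -/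

import Mathlib

namespace GaussianThermo

open Matrix
open scoped ComplexOrder

variable {ι κ : Type*} [Fintype ι] [DecidableEq ι] [Fintype κ] [DecidableEq κ]

/-! Second moments of `ι`-indexed bosonic modes are matrices over `ι ⊕ ι`: `Sum.inl i` is the
position quadrature and `Sum.inr i` the momentum quadrature of mode `i`, with `ħ = 1`, i.e.
`[x_i, p_j] = i δ_ij` and `a_i = (x_i + i p_i) / √2`. -/

/-- `σ` is the covariance matrix of a quantum state of the modes `ι`: a real symmetric matrix
satisfying the uncertainty principle `σ + (i/2) Ω ≥ 0`, where `Ω = [[0, 1], [-1, 0]]`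
(which is `-J` for Mathlib's `J`). -/
def IsCovarianceMatrix (σ : Matrix (ι ⊕ ι) (ι ⊕ ι) ℝ) : Prop :=
  σ.IsSymm ∧ (σ.map (fun r : ℝ => (r : ℂ)) + (Complex.I / 2) • (-(J ι ℂ))).PosSemidef

/-- The matrix `A_ij = ⟨a_j a_i⟩` of a state with vanishing first moments and covariance
matrix `σ`. -/
noncomputable def asymmetryMatrix (σ : Matrix (ι ⊕ ι) (ι ⊕ ι) ℝ) : Matrix ι ι ℂ :=
  Matrix.of fun i j =>
    (((σ (Sum.inl i) (Sum.inl j) - σ (Sum.inr i) (Sum.inr j) : ℝ) : ℂ) +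
      Complex.I * ((σ (Sum.inl i) (Sum.inr j) + σ (Sum.inr i) (Sum.inl j) : ℝ) : ℂ)) / 2

/-- The covariance matrix of a product state of the modes `ι` and the modes `κ`. -/
def productCM (σ : Matrix (ι ⊕ ι) (ι ⊕ ι) ℝ) (τ : Matrix (κ ⊕ κ) (κ ⊕ κ) ℝ) :
    Matrix ((ι ⊕ κ) ⊕ (ι ⊕ κ)) ((ι ⊕ κ) ⊕ (ι ⊕ κ)) ℝ :=
  Matrix.reindex (Equiv.sumSumSumComm ι ι κ κ) (Equiv.sumSumSumComm ι ι κ κ)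
    (Matrix.fromBlocks σ 0 0 τ)

/-- The covariance matrix left after tracing out the modes `κ`. -/
def traceOutCM (σ : Matrix ((ι ⊕ κ) ⊕ (ι ⊕ κ)) ((ι ⊕ κ) ⊕ (ι ⊕ κ)) ℝ) :
    Matrix (ι ⊕ ι) (ι ⊕ ι) ℝ :=
  σ.submatrix (Sum.map Sum.inl Sum.inl) (Sum.map Sum.inl Sum.inl)

/-- Passive linear unitaries: phase-space matrices that are both symplectic and orthogonal. -/
def IsPassive (S : Matrix (ι ⊕ ι) (ι ⊕ ι) ℝ) : Prop :=
  S ∈ Matrix.symplecticGroup ι ℝ ∧ S ∈ Matrix.orthogonalGroup (ι ⊕ ι) ℝ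

/-- The action on covariance matrices of the Gaussian thermal operation that attaches bath
modes `κ` in the thermal state (every quadrature has variance `ν`), applies the passive linear
unitary `S` to all modes, and traces out the bath. -/
def thermalOperation (ν : ℝ) (S : Matrix ((ι ⊕ κ) ⊕ (ι ⊕ κ)) ((ι ⊕ κ) ⊕ (ι ⊕ κ)) ℝ)
    (σ : Matrix (ι ⊕ ι) (ι ⊕ ι) ℝ) : Matrix (ι ⊕ ι) (ι ⊕ ι) ℝ :=
  traceOutCM (S * productCM σ (ν • (1 : Matrix (κ ⊕ κ) (κ ⊕ κ) ℝ)) * Sᵀ)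

/-- `A → A'` under a Gaussian thermal operation with `k` bath modes at background variance `ν`:
some such operation takes the states with asymmetry matrix `A`, of which there is at least one,
to states with asymmetry matrix `A'`. With `k = 0` no bath is used. -/
def AsymmetryGTO (ν : ℝ) (k : ℕ) (A A' : Matrix ι ι ℂ) : Prop :=
  ∃ S : Matrix ((ι ⊕ Fin k) ⊕ (ι ⊕ Fin k)) ((ι ⊕ Fin k) ⊕ (ι ⊕ Fin k)) ℝ, IsPassive S ∧
    (∃ σ : Matrix (ι ⊕ ι) (ι ⊕ ι) ℝ, IsCovarianceMatrix σ ∧ asymmetryMatrix σ = A) ∧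
    ∀ σ : Matrix (ι ⊕ ι) (ι ⊕ ι) ℝ, IsCovarianceMatrix σ → asymmetryMatrix σ = A →
      asymmetryMatrix (thermalOperation ν S σ) = A'

/-- The weak catalytic transformation `A → A'` is possible with `m` catalyst modes and `k` bath
modes: for some catalyst matrix `C`, `A ⊕ C` can be taken to a matrix on system and catalyst
whose system block is `A'` and whose whole catalyst block is again `C`; the blocks coupling
system and catalyst are arbitrary. -/
def WeakCatalytic (ν : ℝ) (m k : ℕ) (A A' : Matrix ι ι ℂ) : Prop :=
  ∃ (C : Matrix (Fin m) (Fin m) ℂ) (B : Matrix (ι ⊕ Fin m) (ι ⊕ Fin m) ℂ),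
    AsymmetryGTO ν k (Matrix.fromBlocks A 0 0 C) B ∧ B.toBlocks₁₁ = A' ∧ B.toBlocks₂₂ = C

/-- The principal mode asymmetries: the singular values of `A`, in descending order. -/
noncomputable def principalAsymmetry {n : ℕ} (A : Matrix (Fin n) (Fin n) ℂ) : Fin n → ℝ :=
  fun i => (Matrix.toEuclideanLin A).singularValues i

/-- Weak majorisation `x ≺_w y` of non-increasingly ordered vectors: every sum of the first `k`
entries of `x` is at most the corresponding sum for `y`. -/
def WeaklyMajorizedBy {n : ℕ} (x y : Fin n → ℝ) : Prop :=
  ∀ k : ℕ, 1 ≤ k → k ≤ n →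
    ∑ i ∈ Finset.univ.filter (fun i : Fin n => (i : ℕ) < k), x i ≤
      ∑ i ∈ Finset.univ.filter (fun i : Fin n => (i : ℕ) < k), y i

end GaussianThermo

/-! Passive operations act on asymmetry matrices by unitary congruence: `a ↦ U a` sends `M` to `U *
M * Uᵀ`. Thermal modes have zero asymmetry, so the bath only pads `A ⊕ C` with a zero block and `ν`
drops out. By the Takagi factorisation `A = X diag(α) Xᵀ`, only the singular values matter.

Necessity (`weaklyMajorizedBy_of_weakCatalytic`): weak majorisation amounts to comparing the sums of
`max (x - t) 0` for all `t ≥ 0`. Takagi-diagonalising the system and catalyst blocks of the output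
puts `α'` and `γ`, the singular values of `C`, on the diagonal of a matrix `G diag(α, γ, 0) Gᵀ` with
`G` unitary. A Ky Fan estimate (`sum_diag_excess_le`) bounds the excess of `(α', γ)` by that of `(α,
γ, 0)`. The excess of `γ` cancels and the zeros contribute none.

Sufficiency (`exists_pair_conversions`): catalyst values `w` are chosen so that `α` and `w` together
regroup into `n` pairs, the `i`-th of which a two-mode unitary turns into `α'ᵢ` and `wᵢ`. The
catalyst block is then diagonal with the same entries as before. This takes `n` catalyst modes and
no bath; any further modes stay idle. -/

namespace GaussianThermo

open Matrix
open scoped ComplexOrder InnerProductSpace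

/-! ### Antilinear symmetric maps and their coneigenvectors. -/

section Takagi

variable {E : Type*} [NormedAddCommGroup E] [InnerProductSpace ℂ E] [FiniteDimensional ℂ E]

/-- A nonzero subspace invariant under a symmetric antilinear map contains a unit vector that is
scaled by a nonnegative real number. -/
theorem exists_unit_coneigenvector (T : E →ₛₗ[starRingEnd ℂ] E)
    (hT : ∀ x y, ⟪x, T y⟫_ℂ = ⟪y, T x⟫_ℂ) (W : Submodule ℂ E) (hW : ∀ w ∈ W, T w ∈ W)
    (hne : W ≠ ⊥) : ∃ v ∈ W, ‖v‖ = 1 ∧ ∃ s : ℝ, 0 ≤ s ∧ T v = (s : ℂ) • v := by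
  have : Nontrivial W := Submodule.nontrivial_iff_ne_bot.2 hne
  -- The square of an antilinear map is linear, so it has an eigenvector `w` in `W`. Symmetry of `T`
  -- then forces the eigenvalue to be `s ^ 2` with `s = ‖T w‖ / ‖w‖`.
  let T2 : E →ₗ[ℂ] E := T.comp T
  have hT2 : ∀ w, T2 w = T (T w) := fun w => rfl
  have hinv : ∀ w ∈ W, T2 w ∈ W := fun w hw => hW _ (hW _ hw)
  obtain ⟨μ, hμ⟩ := Module.End.exists_eigenvalue (T2.restrict hinv)
  obtain ⟨⟨w, hw⟩, hev⟩ := hμ.exists_hasEigenvector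
  have hw0 : w ≠ 0 := fun h => hev.2 (by simpa using h)
  have hTw : T (T w) = μ • w := by
    have := congrArg Subtype.val hev.apply_eq_smul
    exact this
  have hn : μ * (‖w‖ : ℂ) ^ 2 = (‖T w‖ : ℂ) ^ 2 := by
    have h := hT w (T w)
    rw [hTw, inner_smul_right, inner_self_eq_norm_sq_to_K, inner_self_eq_norm_sq_to_K] at h
    simpa using h
  have hwn : ‖w‖ ≠ 0 := norm_ne_zero_iff.2 hw0
  set s : ℝ := ‖T w‖ / ‖w‖ with hs
  have hs0 : 0 ≤ s := by positivity
  have hμs : μ = (s : ℂ) ^ 2 := by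
    rw [hs]; push_cast
    have : (‖w‖ : ℂ) ≠ 0 := by exact_mod_cast hwn
    field_simp
    exact hn
  obtain ⟨z, hzW, hz0, hz⟩ : ∃ z ∈ W, z ≠ 0 ∧ T z = (s : ℂ) • z := by
    -- Since `T (T w) = s² w`, the vector `T w + s w` is scaled by `s`. If it vanishes, then `T w =
    -- -s w`, and antilinearity flips the sign on `I • w`.
    by_cases h : T w + (s : ℂ) • w = 0
    · refine ⟨Complex.I • w, W.smul_mem _ hw, smul_ne_zero Complex.I_ne_zero hw0, ?_⟩
      rw [T.map_smulₛₗ, eq_neg_of_add_eq_zero_left h, smul_comm]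
      simp
    · refine ⟨_, W.add_mem (hW _ hw) (W.smul_mem _ hw), h, ?_⟩
      rw [map_add, hTw, T.map_smulₛₗ, hμs, smul_add, smul_smul, sq, Complex.conj_ofReal, add_comm]
  have hzn : ‖z‖ ≠ 0 := norm_ne_zero_iff.2 hz0
  refine ⟨((‖z‖⁻¹ : ℝ) : ℂ) • z, W.smul_mem _ hzW, ?_, s, hs0, ?_⟩
  · rw [norm_smul]; simp [hzn]
  · rw [T.map_smulₛₗ, hz, smul_comm, Complex.conj_ofReal]

theorem exists_orthonormal_coneigenvectors (T : E →ₛₗ[starRingEnd ℂ] E)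
    (hT : ∀ x y, ⟪x, T y⟫_ℂ = ⟪y, T x⟫_ℂ) (k : ℕ) (hk : k ≤ Module.finrank ℂ E) :
    ∃ v : Fin k → E, Orthonormal ℂ v ∧ ∃ s : Fin k → ℝ,
      (∀ i, 0 ≤ s i) ∧ ∀ i, T (v i) = (s i : ℂ) • v i := by
  induction k with
  | zero => exact ⟨Fin.elim0, by simp [Orthonormal, Pairwise], Fin.elim0, by simp, by simp⟩
  | succ k ih =>
    obtain ⟨v, hv, s, hs0, hs⟩ := ih (by omega)
    -- By symmetry, `T` preserves the orthogonal complement of the vectors already found, which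
    -- supplies the next one.
    set W := (Submodule.span ℂ (Set.range v))ᗮ with hWdef
    have hWmem : ∀ w, w ∈ W ↔ ∀ i, ⟪v i, w⟫_ℂ = 0 := by
      intro w
      rw [hWdef, Submodule.mem_orthogonal]
      constructor
      · intro h i; exact h _ (Submodule.subset_span ⟨i, rfl⟩)
      · intro h u hu
        induction hu using Submodule.span_induction with
        | mem x hx => obtain ⟨i, rfl⟩ := hx; exact h i
        | zero => simp
        | add x y _ _ hx hy => rw [inner_add_left, hx, hy, add_zero]
        | smul a x _ hx => rw [inner_smul_left, hx, mul_zero]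
    have hne : W ≠ ⊥ := by
      intro h
      have h1 := Submodule.orthogonal_eq_bot_iff.1 h
      have h2 : Module.finrank ℂ (Submodule.span ℂ (Set.range v)) = k := by
        rw [finrank_span_eq_card hv.linearIndependent, Fintype.card_fin]
      rw [h1, finrank_top] at h2
      omega
    obtain ⟨z, hzW, hz1, r, hr0, hr⟩ := exists_unit_coneigenvector T hT W (by
      intro w hw
      rw [hWmem] at hw ⊢
      intro i
      rw [hT, hs, inner_smul_right, ← inner_conj_symm, hw, map_zero, mul_zero]) hne
    rw [hWmem] at hzW
    have hzW' : ∀ i, ⟪z, v i⟫_ℂ = 0 := fun i => by rw [← inner_conj_symm, hzW, map_zero]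
    refine ⟨Fin.snoc v z, ?_, Fin.snoc s r, ?_, ?_⟩
    · constructor
      · intro i
        induction i using Fin.lastCases with
        | last => simpa using hz1
        | cast i => simpa using hv.1 i
      · intro i j hij
        induction i using Fin.lastCases with
        | last =>
          induction j using Fin.lastCases with
          | last => exact absurd rfl hij
          | cast j => simpa using hzW' j
        | cast i =>
          induction j using Fin.lastCases with
          | last => simpa using hzW i
          | cast j => simpa using hv.2 (fun h => hij (by rw [h]))
    · intro i
      induction i using Fin.lastCases with
      | last => simpa using hr0
      | cast i => simpa using hs0 i
    · intro i
      induction i using Fin.lastCases with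
      | last => simpa using hr
      | cast i => simpa using hs i

end Takagi

/-! ### Takagi factorisation and singular values. -/

/-- Autonne–Takagi factorisation of a complex symmetric matrix. -/
theorem exists_takagi {n : ℕ} (A : Matrix (Fin n) (Fin n) ℂ) (hA : A.IsSymm) :
    ∃ U ∈ unitaryGroup (Fin n) ℂ, ∃ s : Fin n → ℝ, (∀ i, 0 ≤ s i) ∧
      A = U * diagonal (fun i => (s i : ℂ)) * Uᵀ := by
  -- Symmetry of `A` is symmetry of the antilinear map `v ↦ A v̄`; its coneigenvectors are the
  -- columns of `U`.
  let T : EuclideanSpace ℂ (Fin n) →ₛₗ[starRingEnd ℂ] EuclideanSpace ℂ (Fin n) :=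
    { toFun := fun v => WithLp.toLp 2 (A *ᵥ star (WithLp.ofLp v))
      map_add' := fun x y => by simp [mulVec_add]
      map_smul' := fun c x => by simp [mulVec_smul] }
  have hTv : ∀ v, WithLp.ofLp (T v) = A *ᵥ star (WithLp.ofLp v) := fun v => rfl
  have hT : ∀ x y, ⟪x, T y⟫_ℂ = ⟪y, T x⟫_ℂ := by
    intro x y
    rw [EuclideanSpace.inner_eq_star_dotProduct, EuclideanSpace.inner_eq_star_dotProduct, hTv, hTv,
      dotProduct_comm, dotProduct_mulVec, ← mulVec_transpose, hA.eq, dotProduct_comm,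
      dotProduct_comm]
  obtain ⟨v, hv, s, hs0, hs⟩ := exists_orthonormal_coneigenvectors T hT n (by simp)
  let U : Matrix (Fin n) (Fin n) ℂ := Matrix.of fun i j => v j i
  have hU : Uᴴ * U = 1 := by
    ext i j
    have := orthonormal_iff_ite.1 hv i j
    rw [EuclideanSpace.inner_eq_star_dotProduct] at this
    rw [one_apply, ← this, mul_apply, dotProduct]
    exact Finset.sum_congr rfl fun k _ => by simp [U, mul_comm]
  have hU' : U * Uᴴ = 1 := mul_eq_one_comm.1 hU
  have hAU : A * U.map star = U * diagonal (fun i => (s i : ℂ)) := by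
    ext i j
    have := congrFun (congrArg WithLp.ofLp (hs j)) i
    rw [hTv] at this
    rw [mul_diagonal, mul_apply]
    simp only [mulVec, dotProduct, PiLp.smul_apply, smul_eq_mul] at this
    simpa [U, mul_comm] using this
  have hUc : U.map star * Uᵀ = 1 := by
    ext i j
    have := congrFun (congrFun (congrArg transpose hU') i) j
    rw [transpose_mul, transpose_one] at this
    exact this
  refine ⟨U, mem_unitaryGroup_iff.2 hU', s, hs0, ?_⟩
  rw [← hAU, Matrix.mul_assoc, hUc, Matrix.mul_one]

/-- Functions with the same multiset of values differ by a bijection of their domains. -/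
theorem exists_equiv_of_map_univ_eq {ι κ β : Type*} [Fintype ι] [Fintype κ] [DecidableEq β]
    (f : ι → β) (g : κ → β)
    (h : Finset.univ.val.map f = Finset.univ.val.map g) : ∃ e : ι ≃ κ, f = g ∘ e := by
  have hcard : ∀ b, Fintype.card {i // f i = b} = Fintype.card {j // g j = b} := by
    intro b
    have := congrArg (Multiset.count b) h
    rw [Multiset.count_map, Multiset.count_map] at this
    rw [Fintype.card_subtype, Fintype.card_subtype]
    simpa [Finset.card_def, eq_comm] using this
  let e := (Equiv.sigmaFiberEquiv f).symm.trans
    ((Equiv.sigmaCongrRight fun b => Fintype.equivOfCardEq (hcard b)).trans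
      (Equiv.sigmaFiberEquiv g))
  refine ⟨e, ?_⟩
  funext i
  exact ((Fintype.equivOfCardEq (hcard (f i))) ⟨i, rfl⟩).2.symm

theorem principalAsymmetry_nonneg {n : ℕ} (A : Matrix (Fin n) (Fin n) ℂ) (i : Fin n) :
    0 ≤ principalAsymmetry A i := LinearMap.singularValues_nonneg _ _

theorem principalAsymmetry_antitone {n : ℕ} (A : Matrix (Fin n) (Fin n) ℂ) :
    Antitone (principalAsymmetry A) := fun _ _ h => LinearMap.singularValues_antitone _ h

/-- `Aᴴ * A` is unitarily similar to the diagonal matrix of the `s i ^ 2`, so its characteristic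
polynomial identifies the two families as multisets. A permutation remains because `s` need not be
sorted. -/
theorem exists_equiv_principalAsymmetry {n : ℕ} (U : Matrix (Fin n) (Fin n) ℂ)
    (hU : U ∈ unitaryGroup (Fin n) ℂ) (s : Fin n → ℝ) (hs : ∀ i, 0 ≤ s i) :
    ∃ e : Fin n ≃ Fin n,
      s = principalAsymmetry (U * diagonal (fun i => (s i : ℂ)) * Uᵀ) ∘ e := by
  set A := U * diagonal (fun i => (s i : ℂ)) * Uᵀ with hA
  have hUU : Uᴴ * U = 1 := mem_unitaryGroup_iff'.1 hU
  have hAA : Aᴴ * A = Uᵀᴴ * (diagonal (fun i => ((s i ^ 2 : ℝ) : ℂ)) * Uᵀ) := by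
    have hd : (diagonal (fun i => (s i : ℂ)))ᴴ = diagonal (fun i => (s i : ℂ)) := by
      rw [diagonal_conjTranspose]; congr 1; funext i; simp
    rw [hA, conjTranspose_mul, conjTranspose_mul, hd]
    calc _ = Uᵀᴴ * (diagonal (fun i => (s i : ℂ)) * (Uᴴ * U) *
        diagonal (fun i => (s i : ℂ)) * Uᵀ) := by simp only [Matrix.mul_assoc]
      _ = _ := by
        rw [hUU, Matrix.mul_one, diagonal_mul_diagonal]
        simp [sq]
  have hUt : Uᵀ * Uᵀᴴ = 1 := by
    have := congrArg transpose hUU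
    rwa [transpose_mul, transpose_one] at this
  have hchar : (Aᴴ * A).charpoly =
      ∏ i, (Polynomial.X - Polynomial.C ((s i ^ 2 : ℝ) : ℂ)) := by
    rw [hAA, charpoly_mul_comm, Matrix.mul_assoc, hUt, Matrix.mul_one, charpoly_diagonal]
  have hfr : Module.finrank ℂ (EuclideanSpace ℂ (Fin n)) = n := by simp
  have hlin : (toEuclideanLin A).adjoint ∘ₗ toEuclideanLin A = toEuclideanLin (Aᴴ * A) := by
    rw [← toEuclideanLin_conjTranspose_eq_adjoint]
    ext v
    simp [toLpLin_apply]
  have hroots := (toEuclideanLin A).isSymmetric_adjoint_comp_self.roots_charpoly_eq_eigenvalues hfr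
  have hcl : ((toEuclideanLin A).adjoint ∘ₗ toEuclideanLin A).charpoly = (Aᴴ * A).charpoly := by
    rw [hlin, toEuclideanLin_eq_toLin_orthonormal, charpoly_toLin]
  rw [hcl, hchar, Polynomial.roots_prod _ _
    (Finset.prod_ne_zero_iff.2 fun i _ => Polynomial.X_sub_C_ne_zero _)] at hroots
  simp only [Polynomial.roots_X_sub_C, Multiset.bind_singleton] at hroots
  apply exists_equiv_of_map_univ_eq
  have h2 := congrArg (Multiset.map fun z : ℂ => √z.re) hroots
  rw [Multiset.map_map, Multiset.map_map] at h2
  convert! h2 using 2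
  · rename_i i _
    simp only [Function.comp_apply, Complex.ofReal_re]
    exact (Real.sqrt_sq (hs i)).symm
  · rename_i i _
    exact (toEuclideanLin A).singularValues_fin hfr i

theorem submatrix_mul_diagonal_mul_transpose {ι κ : Type*} [Fintype ι] [Fintype κ]
    [DecidableEq ι] [DecidableEq κ] (U : Matrix ι κ ℂ) (e : ι ≃ κ) (d : κ → ℂ) :
    U.submatrix id e * diagonal (d ∘ e) * (U.submatrix id e)ᵀ = U * diagonal d * Uᵀ := by
  ext i j
  rw [mul_apply, mul_apply]
  simp only [mul_diagonal, transpose_apply, submatrix_apply, id, Function.comp_apply]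
  exact e.sum_comp fun k => U i k * d k * U j k

theorem submatrix_mem_unitaryGroup {ι : Type*} [Fintype ι]
    [DecidableEq ι] {U : Matrix ι ι ℂ} (hU : U ∈ unitaryGroup ι ℂ) (e : ι ≃ ι) :
    U.submatrix id e ∈ unitaryGroup ι ℂ := by
  rw [mem_unitaryGroup_iff] at hU ⊢
  rw [← hU]
  ext i j
  simp only [mul_apply, star_eq_conjTranspose, conjTranspose_apply, submatrix_apply, id]
  exact e.sum_comp fun k => U i k * star (U j k)

/-- Autonne–Takagi factorisation with the singular values in descending order. -/
theorem exists_takagi_principalAsymmetry {n : ℕ} (A : Matrix (Fin n) (Fin n) ℂ) (hA : A.IsSymm) :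
    ∃ U ∈ unitaryGroup (Fin n) ℂ,
      A = U * diagonal (fun i => (principalAsymmetry A i : ℂ)) * Uᵀ := by
  obtain ⟨U, hU, s, hs, h⟩ := exists_takagi A hA
  obtain ⟨e, he⟩ := exists_equiv_principalAsymmetry U hU s hs
  rw [← h] at he
  refine ⟨_, submatrix_mem_unitaryGroup hU e.symm, ?_⟩
  have := submatrix_mul_diagonal_mul_transpose U e.symm (fun i => (s i : ℂ))
  have hc : (fun i => (principalAsymmetry A i : ℂ)) = (fun i => (s i : ℂ)) ∘ e.symm := by
    funext i
    simp [he]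
  rw [hc, this, ← h]

/-! ### Weak majorisation through excess sums. -/

/-- `s'` is weakly majorised by `s`, expressed through the convex functions `x ↦ max (x - t) 0`. -/
def ExcessLE (s' s : Multiset ℝ) : Prop :=
  ∀ t : ℝ, 0 ≤ t → (s'.map fun x => max (x - t) 0).sum ≤ (s.map fun x => max (x - t) 0).sum

theorem excessLE_of_weaklyMajorizedBy {n : ℕ} {x y : Fin n → ℝ} (hx : Antitone x)
    (h : WeaklyMajorizedBy x y) :
    ExcessLE (Finset.univ.val.map x) (Finset.univ.val.map y) := by
  intro t _
  rw [Multiset.map_map, Multiset.map_map]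
  change ∑ i, max (x i - t) 0 ≤ ∑ i, max (y i - t) 0
  -- As `x` is sorted, the entries above `t` form an initial segment; `k` is its length.
  obtain ⟨k, hkn, hk⟩ : ∃ k ≤ n, ∀ i : Fin n, t < x i ↔ (i : ℕ) < k := by
    classical
    by_cases hex : ∃ j : ℕ, ∃ hj : j < n, x ⟨j, hj⟩ ≤ t
    · obtain ⟨hj, hjt⟩ := Nat.find_spec hex
      refine ⟨Nat.find hex, hj.le, fun i => ⟨fun hi => ?_, fun hi => ?_⟩⟩
      · by_contra hc
        exact absurd (hx (Fin.mk_le_of_le_val (not_lt.1 hc) : (⟨_, hj⟩ : Fin n) ≤ i)) (by linarith)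
      · have := Nat.find_min hex hi
        push Not at this
        exact this i.2
    · push Not at hex
      exact ⟨n, le_rfl, fun i => ⟨fun _ => i.2, fun _ => hex i i.2⟩⟩
  calc ∑ i, max (x i - t) 0
      = ∑ i ∈ Finset.univ.filter (fun i : Fin n => (i : ℕ) < k), (x i - t) := by
        rw [Finset.sum_filter]
        refine Finset.sum_congr rfl fun i _ => ?_
        split_ifs with hi
        · exact max_eq_left (by linarith [(hk i).2 hi])
        · exact max_eq_right (by linarith [not_lt.1 (mt (hk i).1 hi)])
    _ ≤ ∑ i ∈ Finset.univ.filter (fun i : Fin n => (i : ℕ) < k), (y i - t) := by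
        rw [Finset.sum_sub_distrib, Finset.sum_sub_distrib]
        rcases Nat.eq_zero_or_pos k with rfl | hk0
        · simp
        · linarith [h k hk0 hkn]
    _ ≤ ∑ i ∈ Finset.univ.filter (fun i : Fin n => (i : ℕ) < k), max (y i - t) 0 :=
        Finset.sum_le_sum fun i _ => le_max_left _ _
    _ ≤ ∑ i, max (y i - t) 0 :=
        Finset.sum_le_sum_of_subset_of_nonneg (Finset.filter_subset _ _)
          fun i _ _ => le_max_right _ _

theorem weaklyMajorizedBy_of_excess_le {n : ℕ} {x y : Fin n → ℝ} (hy : Antitone y)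
    (hy0 : ∀ i, 0 ≤ y i)
    (h : ∀ t : ℝ, 0 ≤ t → ∑ i, max (x i - t) 0 ≤ ∑ i, max (y i - t) 0) :
    WeaklyMajorizedBy x y := by
  intro k hk1 hkn
  -- With `t` equal to the `k`-th largest entry of `y` (index `k - 1`), the excess of `y` is exactly
  -- its first `k` entries minus `k * t`.
  let j : Fin n := ⟨k - 1, by omega⟩
  set t := y j
  have h1 := h t (hy0 j)
  have h2 : ∑ i, max (y i - t) 0 =
      ∑ i ∈ Finset.univ.filter (fun i : Fin n => (i : ℕ) < k), (y i - t) := by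
    rw [Finset.sum_filter]
    refine Finset.sum_congr rfl fun i _ => ?_
    split_ifs with hi
    · exact max_eq_left (sub_nonneg.2 (hy (Fin.mk_le_of_le_val (by simp [j]; omega))))
    · refine max_eq_right (sub_nonpos.2 (hy (Fin.mk_le_of_le_val (by simp; omega))))
  have h3 : ∑ i ∈ Finset.univ.filter (fun i : Fin n => (i : ℕ) < k), (x i - t) ≤
      ∑ i, max (x i - t) 0 :=
    (Finset.sum_le_sum fun i _ => le_max_left _ _).trans
      (Finset.sum_le_sum_of_subset_of_nonneg (Finset.filter_subset _ _)
          fun i _ _ => le_max_right _ _)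
  rw [Finset.sum_sub_distrib] at h2 h3
  linarith

/-! ### Regrouping source and catalyst values into convertible pairs. -/

/-- Sufficient conditions for two modes with asymmetries `x`, `y` to be mixed by a passive
unitary into two modes with asymmetries `a`, `w`. -/
def PairConvertible (x y a w : ℝ) : Prop :=
  (a + w = x + y ∧ y ≤ a ∧ a ≤ x) ∨ (a + w ≤ x + y ∧ w - a = x - y ∧ 0 ≤ a ∧ 0 ≤ w)

theorem sum_map_le_of_forall_le {s : Multiset ℝ} {f : ℝ → ℝ} {c : ℝ} (h : ∀ x ∈ s, f x ≤ c) :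
    (s.map f).sum ≤ s.card * c := by
  have := Multiset.sum_le_card_nsmul (s.map f) c (by simpa using h)
  simpa using this

theorem le_sum_map_of_forall_le {s : Multiset ℝ} {f : ℝ → ℝ} {c : ℝ} (h : ∀ x ∈ s, c ≤ f x) :
    s.card * c ≤ (s.map f).sum := by
  have := Multiset.card_nsmul_le_sum (s := s.map f) (a := c) (by simpa using h)
  simpa using this

theorem excessLE_of_separated {s' s : Multiset ℝ} {a : ℝ} (hcard : s'.card = s.card)
    (h' : ∀ z ∈ s', z ≤ a) (h : ∀ z ∈ s, a ≤ z) : ExcessLE s' s := by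
  intro t _
  calc (s'.map fun x => max (x - t) 0).sum ≤ s'.card * max (a - t) 0 :=
        sum_map_le_of_forall_le fun x hx => max_le_max_right _ (by linarith [h' x hx])
    _ = s.card * max (a - t) 0 := by rw [hcard]
    _ ≤ _ := le_sum_map_of_forall_le fun x hx => max_le_max_right _ (by linarith [h x hx])

/-- Replacing the neighbours `y < a ≤ x` of the largest element `a` on the smaller side by
`x + y - a`, and removing `a`, preserves weak majorisation. -/
theorem excessLE_of_cons_of_neighbours {s' s : Multiset ℝ} {a x y : ℝ}
    (hy0 : 0 ≤ y) (hya : y < a) (hax : a ≤ x) (h' : ∀ z ∈ s', z ≤ a)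
    (hs : ∀ z ∈ s, x ≤ z ∨ z ≤ y) (h : ExcessLE (a ::ₘ s') (x ::ₘ y ::ₘ s)) :
    ExcessLE s' ((x + y - a) ::ₘ s) := by
  -- Below `y` the terms of `a`, `x` and `y` are all linear in `t`, so `a - t` can be moved across.
  have key : ∀ t, 0 ≤ t → t ≤ y → (s'.map fun x => max (x - t) 0).sum ≤
      (x + y - a - t) + (s.map fun x => max (x - t) 0).sum := by
    intro t ht hty
    have := h t ht
    simp only [Multiset.map_cons, Multiset.sum_cons] at this
    rw [max_eq_left (by linarith : 0 ≤ a - t), max_eq_left (by linarith : 0 ≤ x - t),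
      max_eq_left (by linarith : 0 ≤ y - t)] at this
    linarith
  intro t ht
  simp only [Multiset.map_cons, Multiset.sum_cons]
  rcases le_or_gt t y with hty | hty
  · exact (key t ht hty).trans (add_le_add_left (le_max_left _ _) _)
  rcases le_or_gt a t with hat | hat
  · have h0 : (s'.map fun x => max (x - t) 0).sum ≤ s'.card * (0 : ℝ) :=
      sum_map_le_of_forall_le fun z hz => max_le (by linarith [h' z hz]) le_rfl
    have h1 : s.card * (0 : ℝ) ≤ (s.map fun x => max (x - t) 0).sum :=
      le_sum_map_of_forall_le fun z hz => le_max_right _ _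
    linarith [le_max_right (x + y - a - t) 0]
  -- Remaining range `y < t < a`. No element of `s` lies strictly between `y` and `x`, so on `[y,
  -- x]` the excess of `s` is linear with slope `-O.card`.
  · set Q := s'.filter (fun z => t < z)
    set O := s.filter (fun z => x ≤ z)
    have split : ∀ (m : Multiset ℝ) (p : ℝ → Prop) [DecidablePred p] (f : ℝ → ℝ),
        (m.map f).sum = ((m.filter p).map f).sum + ((m.filter fun z => ¬ p z).map f).sum := by
      intro m p _ f
      rw [← Multiset.sum_add, ← Multiset.map_add, Multiset.filter_add_not]
    have hO : ∀ u, y ≤ u → (s.map fun z => max (z - u) 0).sum =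
        (O.map fun z => max (z - u) 0).sum := by
      intro u hu
      rw [split s (fun z => x ≤ z)]
      have : ((s.filter fun z => ¬ x ≤ z).map fun z => max (z - u) 0).sum = 0 := by
        apply Multiset.sum_eq_zero
        intro w hw
        obtain ⟨z, hz, rfl⟩ := Multiset.mem_map.1 hw
        rw [Multiset.mem_filter] at hz
        exact max_eq_right (by linarith [(hs z hz.1).resolve_left hz.2])
      rw [this, add_zero]
    have hOlin : ∀ u, u ≤ x → (O.map fun z => max (z - u) 0).sum =
        O.sum - O.card * u := by
      intro u hu
      rw [Multiset.map_congr rfl (g := fun z => z - u) (by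
        intro z hz
        exact max_eq_left (by linarith [(Multiset.mem_filter.1 hz).2])),
        Multiset.sum_map_sub]
      simp
    have hQ : (s'.map fun z => max (z - t) 0).sum = (Q.map fun z => max (z - t) 0).sum := by
      rw [split s' (fun z => t < z)]
      have : ((s'.filter fun z => ¬ t < z).map fun z => max (z - t) 0).sum = 0 := by
        apply Multiset.sum_eq_zero
        intro w hw
        obtain ⟨z, hz, rfl⟩ := Multiset.mem_map.1 hw
        rw [Multiset.mem_filter] at hz
        exact max_eq_right (by linarith [hz.2])
      rw [this, add_zero]
    have hQlin : ∀ u, u ≤ t → (Q.map fun z => max (z - u) 0).sum =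
        Q.sum - Q.card * u := by
      intro u hu
      rw [Multiset.map_congr rfl (g := fun z => z - u) (by
        intro z hz
        exact max_eq_left (by linarith [(Multiset.mem_filter.1 hz).2])),
        Multiset.sum_map_sub]
      simp
    rw [hQ, hO t hty.le]
    rcases le_or_gt Q.card O.card with hc | hc
    -- Each element of `Q` has excess at most `a - t`, each element of `O` at least that much.
    · have h1 : (Q.map fun z => max (z - t) 0).sum ≤ Q.card * (a - t) :=
        sum_map_le_of_forall_le fun z hz => by
          rw [max_eq_left (by linarith [(Multiset.mem_filter.1 hz).2])]
          linarith [h' z (Multiset.mem_filter.1 hz).1]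
      have h2 : O.card * (a - t) ≤ (O.map fun z => max (z - t) 0).sum :=
        le_sum_map_of_forall_le fun z hz =>
          le_max_of_le_left (by linarith [(Multiset.mem_filter.1 hz).2])
      have hc' : (Q.card : ℝ) ≤ O.card := by exact_mod_cast hc
      have := mul_le_mul_of_nonneg_right hc' (by linarith : 0 ≤ a - t)
      linarith [le_max_right (x + y - a - t) 0]
    -- Start from the inequality at `y`. Going up to `t`, the left side loses at least `Q.card * (t
    -- - y)`, the right side only `(O.card + 1) * (t - y)`.
    · have hk := key y hy0 le_rfl
      rw [hO y le_rfl, hOlin y (by linarith), split s' (fun z => t < z), hQlin y hty.le] at hk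
      have h0 : ((s'.filter fun z => ¬ t < z).card : ℝ) * 0 ≤
          ((s'.filter fun z => ¬ t < z).map fun z => max (z - y) 0).sum :=
        le_sum_map_of_forall_le fun z hz => le_max_right _ _
      rw [hQlin t le_rfl, hOlin t (by linarith)]
      have hc' : (O.card : ℝ) + 1 ≤ Q.card := by exact_mod_cast hc
      have := mul_le_mul_of_nonneg_right hc' (by linarith : 0 ≤ t - y)
      linarith [le_max_left (x + y - a - t) 0]

theorem exists_max_mem {s : Multiset ℝ} (hs : s ≠ 0) : ∃ a ∈ s, ∀ z ∈ s, z ≤ a := by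
  obtain ⟨a, ha, h⟩ := s.toFinset.exists_max_image id (by simpa using hs)
  exact ⟨a, by simpa using ha, fun z hz => h z (by simpa using hz)⟩

theorem exists_min_mem {s : Multiset ℝ} (hs : s ≠ 0) : ∃ a ∈ s, ∀ z ∈ s, a ≤ z := by
  obtain ⟨a, ha, h⟩ := s.toFinset.exists_min_image id (by simpa using hs)
  exact ⟨a, by simpa using ha, fun z hz => h z (by simpa using hz)⟩

/-- Under weak majorisation of the target `s'` by the source `s`, one can choose catalyst values
`w` so that source and catalyst values regroup into pairs `(x, y)`, each convertible into a target
value `a` and a catalyst value `w`. -/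
theorem exists_pair_conversions (n : ℕ) (s' s : Multiset ℝ) (hc' : s'.card = n) (hc : s.card = n)
    (h0' : ∀ z ∈ s', 0 ≤ z) (h0 : ∀ z ∈ s, 0 ≤ z) (h : ExcessLE s' s) :
    ∃ L : Multiset (ℝ × ℝ × ℝ × ℝ),
      (∀ q ∈ L, PairConvertible q.1 q.2.1 q.2.2.1 q.2.2.2) ∧
      L.map (fun q => q.2.2.1) = s' ∧
      L.map (fun q => q.1) + L.map (fun q => q.2.1) = s + L.map (fun q => q.2.2.2) := by
  induction n generalizing s' s with
  | zero =>
    rw [Multiset.card_eq_zero] at hc hc'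
    exact ⟨0, by simp [hc, hc']⟩
  | succ n ih =>
    obtain ⟨a, ha, hamax⟩ := exists_max_mem (s := s') (by rintro rfl; simp at hc')
    obtain ⟨r', rfl⟩ := Multiset.exists_cons_of_mem ha
    have hcr' : r'.card = n := by simpa using hc'
    have h0r' : ∀ z ∈ r', 0 ≤ z := fun z hz => h0' z (Multiset.mem_cons_of_mem hz)
    have hra : ∀ z ∈ r', z ≤ a := fun z hz => hamax z (Multiset.mem_cons_of_mem hz)
    have ha0 : 0 ≤ a := h0' a ha
    -- the largest source value is at least the largest target value
    have hbig : ∃ x ∈ s, a ≤ x := by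
      obtain ⟨b, hb, hbmax⟩ := exists_max_mem (s := s) (by rintro rfl; simp at hc)
      refine ⟨b, hb, ?_⟩
      have h1 := h b (h0 b hb)
      have h2 : (s.map fun x => max (x - b) 0).sum ≤ s.card * (0 : ℝ) :=
        sum_map_le_of_forall_le fun z hz => max_le (by linarith [hbmax z hz]) le_rfl
      have h3 : r'.card * (0 : ℝ) ≤ (r'.map fun x => max (x - b) 0).sum :=
        le_sum_map_of_forall_le fun z hz => le_max_right _ _
      rw [Multiset.map_cons, Multiset.sum_cons] at h1
      linarith [le_max_left (a - b) 0]
    -- it suffices to find one pair conversion that leaves a weakly majorising multiset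
    have step : ∀ x y w r, s = x ::ₘ y ::ₘ r → 0 ≤ w → PairConvertible x y a w →
        ExcessLE r' (w ::ₘ r) → ∃ L : Multiset (ℝ × ℝ × ℝ × ℝ),
          (∀ q ∈ L, PairConvertible q.1 q.2.1 q.2.2.1 q.2.2.2) ∧
          L.map (fun q => q.2.2.1) = a ::ₘ r' ∧
          L.map (fun q => q.1) + L.map (fun q => q.2.1) = s + L.map (fun q => q.2.2.2) := by
      rintro x y w r rfl hw hp hE
      have h0r : ∀ z ∈ r, 0 ≤ z := fun z hz =>
        h0 z (Multiset.mem_cons_of_mem (Multiset.mem_cons_of_mem hz))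
      -- The remaining problem uses `w` as a source value, and the present pair produces it again.
      -- Hence `w` is a catalyst value.
      obtain ⟨L, hL1, hL2, hL3⟩ := ih r' (w ::ₘ r) hcr' (by simpa using hc) h0r'
        (by simpa using ⟨hw, h0r⟩) hE
      refine ⟨(x, y, a, w) ::ₘ L, ?_, by simp [hL2], ?_⟩
      · intro q hq
        rcases Multiset.mem_cons.1 hq with rfl | hq
        · exact hp
        · exact hL1 q hq
      · simp only [Multiset.map_cons, Multiset.cons_add, Multiset.add_cons] at hL3 ⊢
        rw [hL3]
        rw [Multiset.cons_swap y x, Multiset.cons_swap y w, Multiset.cons_swap x w]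
    by_cases hsmall : ∃ y ∈ s, y < a
    -- The pair consists of the source values closest to `a` on either side; it is mixed with its
    -- sum preserved.
    · obtain ⟨y, hy, hymax⟩ := exists_max_mem (s := s.filter (· < a)) (by
        obtain ⟨y, hy, hya⟩ := hsmall
        exact fun h => by simpa [h] using (Multiset.mem_filter (p := (· < a))).2 ⟨hy, hya⟩)
      obtain ⟨x, hx, hxmin⟩ := exists_min_mem (s := s.filter (a ≤ ·)) (by
        obtain ⟨x, hx, hxa⟩ := hbig
        exact fun h => by simpa [h] using (Multiset.mem_filter (p := (a ≤ ·))).2 ⟨hx, hxa⟩)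
      rw [Multiset.mem_filter] at hx hy
      obtain ⟨r₁, rfl⟩ := Multiset.exists_cons_of_mem hx.1
      have hy1 : y ∈ r₁ := 
        (Multiset.mem_cons.1 hy.1).resolve_left (by rintro rfl; linarith [hx.2, hy.2])
      obtain ⟨r, rfl⟩ := Multiset.exists_cons_of_mem hy1
      have hy0 := h0 y hy.1
      refine step x y (x + y - a) r rfl (by linarith [hx.2]) (Or.inl ⟨by ring, hy.2.le, hx.2⟩) ?_
      refine excessLE_of_cons_of_neighbours hy0 hy.2 hx.2 hra ?_ h
      intro z hz
      have hz' : z ∈ x ::ₘ y ::ₘ r := Multiset.mem_cons_of_mem (Multiset.mem_cons_of_mem hz)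
      rcases le_or_gt a z with hza | hza
      · exact Or.inl (hxmin z (Multiset.mem_filter.2 ⟨hz', hza⟩))
      · exact Or.inr (hymax z (Multiset.mem_filter.2 ⟨hz', hza⟩))
    · push Not at hsmall
      rcases Nat.eq_zero_or_pos n with rfl | hn
      -- With a single pair the catalyst must return with its own value: `y = w` in `w - a = x - y`
      -- gives `(a + x) / 2`.
      · obtain ⟨x, rfl⟩ := Multiset.card_eq_one.1 hc
        rw [Multiset.card_eq_zero] at hcr'
        subst hcr'
        have hax := hsmall x (by simp)
        refine ⟨{(x, (a + x) / 2, a, (a + x) / 2)}, ?_, by simp, by simp⟩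
        intro q hq
        rw [Multiset.mem_singleton] at hq
        subst hq
        exact Or.inr ⟨by simp only; linarith, by simp only; ring, ha0, by simp only; linarith⟩
      -- With `y` minimal, `w = a + x - y` is at least `a`. So `a` separates the remaining targets
      -- from the remaining sources.
      · obtain ⟨y, hy, hymin⟩ := exists_min_mem (s := s) (by rintro rfl; simp at hc)
        obtain ⟨r₁, rfl⟩ := Multiset.exists_cons_of_mem hy
        obtain ⟨x, hx⟩ := Multiset.exists_mem_of_ne_zero (s := r₁)
          (by rintro rfl; simp at hc; omega)
        obtain ⟨r, rfl⟩ := Multiset.exists_cons_of_mem hx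
        have hxy : y ≤ x := hymin x (by simp)
        have hay : a ≤ y := hsmall y hy
        refine step x y (a + x - y) r (Multiset.cons_swap _ _ _) (by linarith)
          (Or.inr ⟨by linarith, by ring, ha0, by linarith⟩) ?_
        refine excessLE_of_separated (a := a) (by simpa [hcr'] using hc.symm) hra ?_
        intro z hz
        rcases Multiset.mem_cons.1 hz with rfl | hz
        · linarith
        · exact hsmall z (by simp [hz])

/-- Indexed form of `exists_pair_conversions`. -/
theorem exists_pair_conversions_of_weaklyMajorizedBy {n : ℕ} {a s : Fin n → ℝ}
    (ha : Antitone a) (ha0 : ∀ i, 0 ≤ a i) (hs0 : ∀ i, 0 ≤ s i) (h : WeaklyMajorizedBy a s) :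
    ∃ (x y w : Fin n → ℝ) (e : Fin n ⊕ Fin n ≃ Fin n ⊕ Fin n),
      (∀ i, PairConvertible (x i) (y i) (a i) (w i)) ∧
      Sum.elim x y = Sum.elim s w ∘ e := by
  obtain ⟨L, hL, hLa, hLs⟩ := exists_pair_conversions n (Finset.univ.val.map a)
    (Finset.univ.val.map s) (by simp) (by simp) (by simpa using ha0) (by simpa using hs0)
    (excessLE_of_weaklyMajorizedBy ha h)
  have hcard : L.card = n := by simpa using congrArg Multiset.card hLa
  obtain ⟨f, rfl⟩ : ∃ f : Fin n → ℝ × ℝ × ℝ × ℝ, L = Finset.univ.val.map f := by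
    subst hcard
    refine ⟨fun i => L.toList.get (i.cast (by simp)), ?_⟩
    rw [Fin.univ_val_map]
    conv_lhs => rw [← L.coe_toList]
    congr 1
    apply List.ext_get <;> simp
  rw [Multiset.map_map] at hLa
  -- Reorders the pairs so that the `i`-th one produces `a i`.
  obtain ⟨σ, hσ⟩ := exists_equiv_of_map_univ_eq _ _ hLa.symm
  have hperm : ∀ g : ℝ × ℝ × ℝ × ℝ → ℝ,
      (Finset.univ.val.map f).map g = Finset.univ.val.map (fun i => g (f (σ i))) := by
    intro g
    conv_lhs => rw [← Multiset.map_univ_val_equiv σ, Multiset.map_map, Multiset.map_map]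
    rfl
  have hsum : ∀ u v : Fin n → ℝ, (Finset.univ.val.map (Sum.elim u v)) =
      Finset.univ.val.map u + Finset.univ.val.map v := by
    intro u v
    rw [← Finset.univ_disjSum_univ, Finset.val_disjSum, Multiset.disjSum, Multiset.map_add,
      Multiset.map_map, Multiset.map_map]
    rfl
  rw [hperm, hperm, hperm, ← hsum, ← hsum] at hLs
  obtain ⟨e, he⟩ := exists_equiv_of_map_univ_eq _ _ hLs
  refine ⟨_, _, _, e, fun i => ?_, he⟩
  have := hL (f (σ i)) (Multiset.mem_map_of_mem _ (Finset.mem_univ_val _))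
  rwa [show a i = (f (σ i)).2.2.1 from congrFun hσ i]

/-! ### From covariance matrices to unitary congruence. -/

section PhaseSpace

variable {ι κ : Type*}

theorem asymmetryMatrix_isSymm {σ : Matrix (ι ⊕ ι) (ι ⊕ ι) ℝ} (hσ : σ.IsSymm) :
    (asymmetryMatrix σ).IsSymm := by
  ext i j
  have h := fun a b => hσ.apply a b
  simp only [asymmetryMatrix, transpose_apply, of_apply]
  rw [h (Sum.inl i), h (Sum.inr i), h (Sum.inl i), h (Sum.inr i), add_comm (σ (Sum.inr _) _)]

theorem asymmetryMatrix_traceOutCM (σ : Matrix ((ι ⊕ κ) ⊕ (ι ⊕ κ)) ((ι ⊕ κ) ⊕ (ι ⊕ κ)) ℝ) :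
    asymmetryMatrix (traceOutCM σ) = (asymmetryMatrix σ).toBlocks₁₁ := rfl

/-- A multiple of the identity has equal position and momentum variances and no correlations, hence
zero asymmetry. -/
theorem asymmetryMatrix_productCM_thermal [DecidableEq κ] (σ : Matrix (ι ⊕ ι) (ι ⊕ ι) ℝ) (ν : ℝ) :
    asymmetryMatrix (productCM σ (ν • (1 : Matrix (κ ⊕ κ) (κ ⊕ κ) ℝ))) =
      fromBlocks (asymmetryMatrix σ) 0 0 0 := by
  ext i j
  rcases i with i | i <;> rcases j with j | j <;>
    simp [asymmetryMatrix, productCM, Equiv.sumSumSumComm, one_apply]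

variable [Fintype ι] [DecidableEq ι] [Fintype κ] [DecidableEq κ]

/-- The matrix of coefficients of `√2 a = x + i p`. -/
noncomputable def ladder (ι : Type*) [DecidableEq ι] : Matrix ι (ι ⊕ ι) ℂ :=
  fromCols 1 (Complex.I • 1)

theorem ladder_mul_conjTranspose : ladder ι * (ladder ι)ᴴ = (2 : ℂ) • 1 := by
  rw [ladder, conjTranspose_fromCols_eq_fromRows_conjTranspose, fromCols_mul_fromRows,
    conjTranspose_smul, conjTranspose_one, smul_mul_smul_comm, Matrix.one_mul]
  simp [two_smul]

theorem asymmetryMatrix_eq (σ : Matrix (ι ⊕ ι) (ι ⊕ ι) ℝ) :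
    asymmetryMatrix σ =
      (1 / 2 : ℂ) • (ladder ι * σ.map Complex.ofReal * (ladder ι)ᵀ) := by
  obtain ⟨a, b, c, d, rfl⟩ : ∃ a b c d, σ = fromBlocks a b c d :=
    ⟨_, _, _, _, (fromBlocks_toBlocks σ).symm⟩
  rw [ladder, fromBlocks_map, fromCols_mul_fromBlocks, transpose_fromCols, fromCols_mul_fromRows]
  ext i j
  simp [asymmetryMatrix]
  ring_nf
  simp
  ring

theorem asymmetryMatrix_conj {S σ : Matrix (ι ⊕ ι) (ι ⊕ ι) ℝ} {U : Matrix ι ι ℂ}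
    (h : ladder ι * S.map Complex.ofReal = U * ladder ι) :
    asymmetryMatrix (S * σ * Sᵀ) = U * asymmetryMatrix σ * Uᵀ := by
  have h' := congrArg transpose h
  rw [transpose_mul, transpose_mul] at h'
  have hm : (S * σ * Sᵀ).map Complex.ofReal =
      S.map Complex.ofReal * σ.map Complex.ofReal * (S.map Complex.ofReal)ᵀ := by
    change (S * σ * Sᵀ).map Complex.ofRealHom = _
    rw [Matrix.map_mul, Matrix.map_mul]
    rfl
  rw [asymmetryMatrix_eq, asymmetryMatrix_eq, hm, Matrix.mul_smul, Matrix.smul_mul]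
  congr 1
  calc _ = (ladder ι * S.map Complex.ofReal) * σ.map Complex.ofReal *
        ((S.map Complex.ofReal)ᵀ * (ladder ι)ᵀ) := by simp only [Matrix.mul_assoc]
    _ = _ := by rw [h, h']; simp only [Matrix.mul_assoc]

theorem exists_unitary_of_isPassive {S : Matrix (ι ⊕ ι) (ι ⊕ ι) ℝ} (hS : IsPassive S) :
    ∃ U ∈ unitaryGroup ι ℂ, ladder ι * S.map Complex.ofReal = U * ladder ι := by
  obtain ⟨h1, h2⟩ := hS
  rw [SymplecticGroup.mem_iff] at h1
  have h3 : S * Sᵀ = 1 := (mem_orthogonalGroup_iff _ _).1 h2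
  have h4 : Sᵀ * S = 1 := (mem_orthogonalGroup_iff' _ _).1 h2
  -- An orthogonal symplectic matrix commutes with `J`, so it has blocks `d, -c, c, d` and encodes
  -- the complex matrix `d + i c`.
  have hcomm : S * J ι ℝ = J ι ℝ * S := by
    rw [← h1, Matrix.mul_assoc (S * J ι ℝ), h4, Matrix.mul_one, h1]
  obtain ⟨a, b, c, d, rfl⟩ : ∃ a b c d, S = fromBlocks a b c d :=
    ⟨_, _, _, _, (fromBlocks_toBlocks S).symm⟩
  rw [J, fromBlocks_multiply, fromBlocks_multiply, fromBlocks_inj] at hcomm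
  simp only [Matrix.mul_zero, Matrix.mul_one, Matrix.mul_neg, Matrix.zero_mul, Matrix.one_mul,
    Matrix.neg_mul, zero_add, add_zero] at hcomm
  obtain ⟨rfl, -, rfl, -⟩ := hcomm
  have hL : ladder ι * (fromBlocks d (-c) c d).map Complex.ofReal =
      (d.map Complex.ofReal + Complex.I • c.map Complex.ofReal) * ladder ι := by
    rw [ladder, fromBlocks_map, fromCols_mul_fromBlocks, mul_fromCols]
    congr 1
    · simp
    · ext i j
      simp
      ring_nf
      simp
  refine ⟨d.map Complex.ofReal + Complex.I • c.map Complex.ofReal, ?_, hL⟩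
  set S := fromBlocks d (-c) c d
  set U := d.map Complex.ofReal + Complex.I • c.map Complex.ofReal
  have hSS : S.map Complex.ofReal * (S.map Complex.ofReal)ᴴ = 1 := by
    have : (S.map Complex.ofReal)ᴴ = Sᵀ.map Complex.ofRealHom := by
      ext i j
      simp
    rw [this]
    change S.map Complex.ofRealHom * _ = 1
    rw [← Matrix.map_mul, h3, Matrix.map_one _ (map_zero _) (map_one _)]
  have h2 : (2 : ℂ) • (U * Uᴴ) = (2 : ℂ) • 1 := by
    calc (2 : ℂ) • (U * Uᴴ) = U * (ladder ι * (ladder ι)ᴴ) * Uᴴ := by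
          rw [ladder_mul_conjTranspose]; simp
      _ = (U * ladder ι) * (U * ladder ι)ᴴ := by
          rw [conjTranspose_mul]; simp only [Matrix.mul_assoc]
      _ = ladder ι * (S.map Complex.ofReal * (S.map Complex.ofReal)ᴴ) * (ladder ι)ᴴ := by
          rw [← hL, conjTranspose_mul]; simp only [Matrix.mul_assoc]
      _ = (2 : ℂ) • 1 := by rw [hSS, Matrix.mul_one, ladder_mul_conjTranspose]
  exact mem_unitaryGroup_iff.2 (smul_right_injective _ two_ne_zero h2)

/-- The real phase-space matrix of the passive transformation `a ↦ U a`. -/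
noncomputable def phaseSpaceMatrix (U : Matrix ι ι ℂ) : Matrix (ι ⊕ ι) (ι ⊕ ι) ℝ :=
  fromBlocks (U.map Complex.re) (-U.map Complex.im) (U.map Complex.im) (U.map Complex.re)

theorem ladder_mul_phaseSpaceMatrix (U : Matrix ι ι ℂ) :
    ladder ι * (phaseSpaceMatrix U).map Complex.ofReal = U * ladder ι := by
  rw [ladder, phaseSpaceMatrix, fromBlocks_map, fromCols_mul_fromBlocks, mul_fromCols]
  congr 1
  · ext i j
    simp [mul_comm Complex.I]
  · ext i j
    simp
    conv_rhs => rw [← Complex.re_add_im (U i j)]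
    ring_nf
    simp

theorem isPassive_phaseSpaceMatrix {U : Matrix ι ι ℂ} (hU : U ∈ unitaryGroup ι ℂ) :
    IsPassive (phaseSpaceMatrix U) := by
  have hUU := mem_unitaryGroup_iff.1 hU
  have h1 : U.map Complex.re * (U.map Complex.re)ᵀ + U.map Complex.im * (U.map Complex.im)ᵀ = 1 := by
    ext i j
    have := congrArg Complex.re (congrFun (congrFun hUU i) j)
    rw [mul_apply, Complex.re_sum] at this
    rw [Matrix.add_apply, mul_apply, mul_apply, ← Finset.sum_add_distrib]
    simp at this
    simp [this, one_apply]
    split_ifs <;> simp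
  have h2 : U.map Complex.re * (U.map Complex.im)ᵀ = U.map Complex.im * (U.map Complex.re)ᵀ := by
    ext i j
    have := congrArg Complex.im (congrFun (congrFun hUU i) j)
    rw [mul_apply, Complex.im_sum] at this
    rw [mul_apply, mul_apply, ← sub_eq_zero, ← Finset.sum_sub_distrib]
    have h0 : ((1 : Matrix ι ι ℂ) i j).im = 0 := by
      rw [one_apply]
      split_ifs <;> simp
    rw [h0, ← neg_eq_zero, ← Finset.sum_neg_distrib] at this
    rw [← this]
    refine Finset.sum_congr rfl fun k _ => ?_
    simp
    ring
  have h3 : phaseSpaceMatrix U * (phaseSpaceMatrix U)ᵀ = 1 := by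
    rw [phaseSpaceMatrix, fromBlocks_transpose, fromBlocks_multiply, ← fromBlocks_one,
      fromBlocks_inj]
    simp [h1, h2, add_comm (U.map Complex.im * _)]
  refine ⟨?_, (mem_orthogonalGroup_iff _ _).2 h3⟩
  have hcomm : phaseSpaceMatrix U * J ι ℝ = J ι ℝ * phaseSpaceMatrix U := by
    rw [phaseSpaceMatrix, J, fromBlocks_multiply, fromBlocks_multiply, fromBlocks_inj]
    simp
  rw [SymplecticGroup.mem_iff, hcomm, Matrix.mul_assoc, h3, Matrix.mul_one]

theorem asymmetryMatrix_thermalOperation (ν : ℝ)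
    {S : Matrix ((ι ⊕ κ) ⊕ (ι ⊕ κ)) ((ι ⊕ κ) ⊕ (ι ⊕ κ)) ℝ} {U : Matrix (ι ⊕ κ) (ι ⊕ κ) ℂ}
    (h : ladder (ι ⊕ κ) * S.map Complex.ofReal = U * ladder (ι ⊕ κ))
    (σ : Matrix (ι ⊕ ι) (ι ⊕ ι) ℝ) :
    asymmetryMatrix (thermalOperation ν S σ) =
      (U * fromBlocks (asymmetryMatrix σ) 0 0 0 * Uᵀ).toBlocks₁₁ := by
  rw [thermalOperation, asymmetryMatrix_traceOutCM, asymmetryMatrix_conj h,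
    asymmetryMatrix_productCM_thermal]

theorem exists_add_posSemidef (H : Matrix ι ι ℂ) (hH : H.IsHermitian) :
    ∃ t : ℝ, (((t : ℂ) • (1 : Matrix ι ι ℂ)) + H).PosSemidef := by
  refine ⟨∑ i, |hH.eigenvalues i|, ?_⟩
  set t := ∑ i, |hH.eigenvalues i|
  set V : Matrix ι ι ℂ := hH.eigenvectorUnitary.1
  have hV : V * Vᴴ = 1 := mem_unitaryGroup_iff.1 hH.eigenvectorUnitary.2
  have hs : H = V * diagonal (fun i => (hH.eigenvalues i : ℂ)) * Vᴴ := hH.spectral_theorem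
  have : (t : ℂ) • (1 : Matrix ι ι ℂ) + H =
      V * diagonal (fun i => ((t + hH.eigenvalues i : ℝ) : ℂ)) * Vᴴ := by
    have hd : diagonal (fun i => ((t + hH.eigenvalues i : ℝ) : ℂ)) =
        (t : ℂ) • (1 : Matrix ι ι ℂ) + diagonal (fun i => (hH.eigenvalues i : ℂ)) := by
      rw [smul_one_eq_diagonal, diagonal_add]
      simp
    rw [hd, Matrix.mul_add, Matrix.add_mul, ← hs]
    simp [hV]
  rw [this]
  refine PosSemidef.mul_mul_conjTranspose_same (PosSemidef.diagonal fun i => ?_) V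
  rw [Pi.zero_apply, Complex.zero_le_real]
  have := Finset.single_le_sum (f := fun i => |hH.eigenvalues i|) (fun i _ => abs_nonneg _)
    (Finset.mem_univ i)
  linarith [neg_abs_le (hH.eigenvalues i)]

/-- Adding `t • 1` leaves the asymmetry unchanged, and a large `t` enforces the uncertainty
principle. -/
theorem exists_isCovarianceMatrix (A : Matrix ι ι ℂ) (hA : A.IsSymm) :
    ∃ σ : Matrix (ι ⊕ ι) (ι ⊕ ι) ℝ, IsCovarianceMatrix σ ∧ asymmetryMatrix σ = A := by
  set σ₀ : Matrix (ι ⊕ ι) (ι ⊕ ι) ℝ :=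
    fromBlocks (A.map Complex.re) (A.map Complex.im) (A.map Complex.im) (-A.map Complex.re)
  have hsymm : σ₀.IsSymm := by
    have h1 : (A.map Complex.re)ᵀ = A.map Complex.re := by rw [← transpose_map, hA.eq]
    have h2 : (A.map Complex.im)ᵀ = A.map Complex.im := by rw [← transpose_map, hA.eq]
    rw [IsSymm, fromBlocks_transpose, transpose_neg, h1, h2]
  have hH : (σ₀.map Complex.ofReal + (Complex.I / 2) • (-(J ι ℂ))).IsHermitian := by
    apply IsHermitian.add
    · ext i j
      simp [hsymm.apply]
    · rw [IsHermitian, conjTranspose_smul, conjTranspose_neg, J, fromBlocks_conjTranspose]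
      ext i j
      rcases i with i | i <;> rcases j with j | j <;> simp [one_apply] <;> split_ifs <;> simp_all [neg_div]
  obtain ⟨t, ht⟩ := exists_add_posSemidef _ hH
  refine ⟨t • 1 + σ₀, ⟨?_, ?_⟩, ?_⟩
  · rw [IsSymm, transpose_add, hsymm.eq, transpose_smul, transpose_one]
  · convert ht using 1
    rw [← add_assoc]
    congr 1
    ext i j
    simp [one_apply]
    split_ifs <;> simp
  · ext i j
    simp only [asymmetryMatrix, of_apply, Matrix.add_apply, Matrix.smul_apply, σ₀, fromBlocks_apply₁₁,
      fromBlocks_apply₁₂, fromBlocks_apply₂₁, fromBlocks_apply₂₂, map_apply, Matrix.neg_apply]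
    simp [one_apply]
    linear_combination Complex.re_add_im (A i j)

end PhaseSpace

/-! ### Congruence by block-diagonal unitaries. -/

section BlockAlgebra

variable {ι κ : Type*} [Fintype ι] [Fintype κ]

theorem blockDiagonal_conj (X : Matrix ι ι ℂ) (Z : Matrix κ κ ℂ) (M : Matrix (ι ⊕ κ) (ι ⊕ κ) ℂ) :
    fromBlocks X 0 0 Z * M * (fromBlocks X 0 0 Z)ᵀ =
      fromBlocks (X * M.toBlocks₁₁ * Xᵀ) (X * M.toBlocks₁₂ * Zᵀ)
        (Z * M.toBlocks₂₁ * Xᵀ) (Z * M.toBlocks₂₂ * Zᵀ) := by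
  conv_lhs => rw [← fromBlocks_toBlocks M]
  simp [fromBlocks_multiply, fromBlocks_transpose]

variable [DecidableEq ι] [DecidableEq κ]

theorem fromBlocks_mem_unitaryGroup {X : Matrix ι ι ℂ} {Z : Matrix κ κ ℂ}
    (hX : X ∈ unitaryGroup ι ℂ) (hZ : Z ∈ unitaryGroup κ ℂ) :
    fromBlocks X 0 0 Z ∈ unitaryGroup (ι ⊕ κ) ℂ := by
  rw [mem_unitaryGroup_iff, star_eq_conjTranspose] at *
  rw [fromBlocks_conjTranspose, fromBlocks_multiply]
  simp [hX, hZ]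

theorem conjTranspose_mem_unitaryGroup {X : Matrix ι ι ℂ} (hX : X ∈ unitaryGroup ι ℂ) :
    Xᴴ ∈ unitaryGroup ι ℂ := Unitary.star_mem hX

theorem transpose_mem_unitaryGroup {X : Matrix ι ι ℂ} (hX : X ∈ unitaryGroup ι ℂ) :
    Xᵀ ∈ unitaryGroup ι ℂ := by
  have h := congrArg transpose (mem_unitaryGroup_iff'.1 hX)
  rw [transpose_mul, transpose_one] at h
  exact mem_unitaryGroup_iff.2 h

theorem conjTranspose_conj_cancel {X : Matrix ι ι ℂ} (hX : X ∈ unitaryGroup ι ℂ)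
    (D : Matrix ι ι ℂ) : Xᴴ * (X * D * Xᵀ) * Xᴴᵀ = D := by
  have h1 : Xᴴ * X = 1 := mem_unitaryGroup_iff'.1 hX
  have h2 : Xᵀ * Xᴴᵀ = 1 := by rw [← transpose_mul, h1, transpose_one]
  calc _ = (Xᴴ * X) * D * (Xᵀ * Xᴴᵀ) := by simp only [Matrix.mul_assoc]
    _ = D := by rw [h1, h2, Matrix.one_mul, Matrix.mul_one]

end BlockAlgebra

/-! ### Reformulation of catalysis by unitaries. -/

section PassiveUnitaries

variable {ι : Type*} [Fintype ι] [DecidableEq ι]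

/-- Weak catalytic transformations in terms of unitaries acting by congruence on asymmetry
matrices. -/
theorem weakCatalytic_iff (ν : ℝ) (m k : ℕ) (A A' : Matrix ι ι ℂ) (hA : A.IsSymm) :
    WeakCatalytic ν m k A A' ↔ ∃ (C : Matrix (Fin m) (Fin m) ℂ)
      (U : Matrix ((ι ⊕ Fin m) ⊕ Fin k) ((ι ⊕ Fin m) ⊕ Fin k) ℂ), C.IsSymm ∧
      U ∈ unitaryGroup _ ℂ ∧
      (U * fromBlocks (fromBlocks A 0 0 C) 0 0 0 * Uᵀ).toBlocks₁₁.toBlocks₁₁ = A' ∧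
      (U * fromBlocks (fromBlocks A 0 0 C) 0 0 0 * Uᵀ).toBlocks₁₁.toBlocks₂₂ = C := by
  constructor
  · rintro ⟨C, B, ⟨S, hS, ⟨σ, hσ, hσA⟩, h⟩, h1, h2⟩
    obtain ⟨U, hU, hSU⟩ := exists_unitary_of_isPassive hS
    have hB := h σ hσ hσA
    rw [asymmetryMatrix_thermalOperation ν hSU, hσA] at hB
    have hC : C.IsSymm := by
      have := asymmetryMatrix_isSymm hσ.1
      rw [hσA, isSymm_fromBlocks_iff] at this
      exact this.2.2.2
    exact ⟨C, U, hC, hU, by rw [hB, h1], by rw [hB, h2]⟩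
  · rintro ⟨C, U, hC, hU, h1, h2⟩
    refine ⟨C, _, ⟨phaseSpaceMatrix U, isPassive_phaseSpaceMatrix hU,
      exists_isCovarianceMatrix _ ?_, fun σ _ hσA => ?_⟩, h1, h2⟩
    · rw [isSymm_fromBlocks_iff]
      exact ⟨hA, by simp, by simp, hC⟩
    · rw [asymmetryMatrix_thermalOperation ν (ladder_mul_phaseSpaceMatrix U), hσA]

end PassiveUnitaries

/-! ### Necessity of weak majorisation. -/

section Necessity

theorem sum_normSq_row {N : Type*} [Fintype N] [DecidableEq N] {U : Matrix N N ℂ}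
    (hU : U ∈ unitaryGroup N ℂ) (i : N) : ∑ j, Complex.normSq (U i j) = 1 := by
  have h := congrFun (congrFun (mem_unitaryGroup_iff.1 hU) i) i
  rw [mul_apply, one_apply_eq] at h
  have h2 : ((∑ j, Complex.normSq (U i j) : ℝ) : ℂ) = 1 := by
    rw [← h, Complex.ofReal_sum]
    exact Finset.sum_congr rfl fun j _ => (Complex.mul_conj _).symm
  exact_mod_cast h2

/-- A Ky Fan type inequality: for unitary `U` and `V`, any selection of diagonal entries of
`U diag(s) V` has excess over `t` bounded by that of `s`. -/
theorem sum_diag_excess_le {N : Type*} [Fintype N] [DecidableEq N] {U V : Matrix N N ℂ}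
    (hU : U ∈ unitaryGroup N ℂ) (hV : V ∈ unitaryGroup N ℂ) (s : N → ℝ) (hs : ∀ i, 0 ≤ s i)
    (t : ℝ) (P : N → Bool) :
    ∑ i, (if P i then ((U * diagonal (fun j => (s j : ℂ)) * V) i i).re - t else 0) ≤
      ∑ j, max (s j - t) 0 := by
  -- Averaging the squared moduli of `U` and `Vᵀ` gives a doubly stochastic matrix. Since `Re (u v)
  -- ≤ (|u|² + |v|²) / 2`, it dominates the diagonal entries.
  set e : N → N → ℝ := fun i j => (Complex.normSq (U i j) + Complex.normSq (V j i)) / 2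
  have he0 : ∀ i j, 0 ≤ e i j := fun i j =>
    div_nonneg (add_nonneg (Complex.normSq_nonneg _) (Complex.normSq_nonneg _)) zero_le_two
  have hrow : ∀ i, ∑ j, e i j = 1 := by
    intro i
    rw [← Finset.sum_div, Finset.sum_add_distrib, sum_normSq_row hU,
      show ∑ j, Complex.normSq (V j i) = 1 from sum_normSq_row (transpose_mem_unitaryGroup hV) i]
    norm_num
  have hcol : ∀ j, ∑ i, e i j = 1 := by
    intro j
    rw [← Finset.sum_div, Finset.sum_add_distrib, sum_normSq_row hV,
      show ∑ i, Complex.normSq (U i j) = 1 from sum_normSq_row (transpose_mem_unitaryGroup hU) j]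
    norm_num
  have hbound : ∀ i, ((U * diagonal (fun j => (s j : ℂ)) * V) i i).re - t ≤
      ∑ j, e i j * (s j - t) := by
    intro i
    simp only [mul_sub, Finset.sum_sub_distrib, ← Finset.sum_mul, hrow, one_mul]
    refine sub_le_sub_right ?_ t
    rw [mul_apply, Complex.re_sum]
    refine Finset.sum_le_sum fun j _ => ?_
    rw [mul_diagonal]
    have h1 : (U i j * (s j : ℂ) * V j i).re =
        s j * ((U i j).re * (V j i).re - (U i j).im * (V j i).im) := by
      simp
      ring
    rw [h1, mul_comm]
    refine mul_le_mul_of_nonneg_right ?_ (hs j)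
    simp only [e, Complex.normSq_apply]
    nlinarith [sq_nonneg ((U i j).re - (V j i).re), sq_nonneg ((U i j).im + (V j i).im)]
  calc _ ≤ ∑ i, ∑ j, e i j * max (s j - t) 0 := by
        refine Finset.sum_le_sum fun i _ => ?_
        split_ifs
        · exact (hbound i).trans (Finset.sum_le_sum fun j _ =>
            mul_le_mul_of_nonneg_left (le_max_left _ _) (he0 i j))
        · exact Finset.sum_nonneg fun j _ => mul_nonneg (he0 i j) (le_max_right _ _)
    _ = _ := by
        rw [Finset.sum_comm]
        simp only [← Finset.sum_mul, hcol, one_mul]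

theorem weaklyMajorizedBy_of_weakCatalytic {n m k : ℕ} {ν : ℝ} {A A' : Matrix (Fin n) (Fin n) ℂ}
    (hA : A.IsSymm) (hA' : A'.IsSymm) (h : WeakCatalytic ν m k A A') :
    WeaklyMajorizedBy (principalAsymmetry A') (principalAsymmetry A) := by
  obtain ⟨C, U, hC, hU, h1, h2⟩ := (weakCatalytic_iff ν m k A A' hA).1 h
  refine weaklyMajorizedBy_of_excess_le (principalAsymmetry_antitone A)
    (principalAsymmetry_nonneg A) fun t ht => ?_
  obtain ⟨X, hX, hXA⟩ := exists_takagi_principalAsymmetry A hA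
  obtain ⟨X', hX', hXA'⟩ := exists_takagi_principalAsymmetry A' hA'
  obtain ⟨Z, hZ, hZC⟩ := exists_takagi_principalAsymmetry C hC
  set α := principalAsymmetry A
  set α' := principalAsymmetry A'
  set γ := principalAsymmetry C
  set M := U * fromBlocks (fromBlocks A 0 0 C) 0 0 0 * Uᵀ with hM
  let s : (Fin n ⊕ Fin m) ⊕ Fin k → ℝ := Sum.elim (Sum.elim α γ) 0
  let W : Matrix ((Fin n ⊕ Fin m) ⊕ Fin k) ((Fin n ⊕ Fin m) ⊕ Fin k) ℂ :=
    fromBlocks (fromBlocks X 0 0 Z) 0 0 1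
  let W' : Matrix ((Fin n ⊕ Fin m) ⊕ Fin k) ((Fin n ⊕ Fin m) ⊕ Fin k) ℂ :=
    fromBlocks (fromBlocks X'ᴴ 0 0 Zᴴ) 0 0 1
  have hW : W ∈ unitaryGroup _ ℂ :=
    fromBlocks_mem_unitaryGroup (fromBlocks_mem_unitaryGroup hX hZ) (one_mem _)
  have hW' : W' ∈ unitaryGroup _ ℂ :=
    fromBlocks_mem_unitaryGroup (fromBlocks_mem_unitaryGroup
      (conjTranspose_mem_unitaryGroup hX') (conjTranspose_mem_unitaryGroup hZ)) (one_mem _)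
  have hs : diagonal (fun i => (s i : ℂ)) =
      fromBlocks (fromBlocks (diagonal fun i => (α i : ℂ)) 0 0 (diagonal fun i => (γ i : ℂ)))
        0 0 0 := by
    ext (( i | i) | i) ((j | j) | j) <;> simp [s, diagonal_apply]
  have hM0 : fromBlocks (fromBlocks A 0 0 C) 0 0 (0 : Matrix (Fin k) (Fin k) ℂ) =
      W * diagonal (fun i => (s i : ℂ)) * Wᵀ := by
    rw [hs, blockDiagonal_conj]
    simp only [toBlocks_fromBlocks₁₁, toBlocks_fromBlocks₁₂, toBlocks_fromBlocks₂₁,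
      toBlocks_fromBlocks₂₂]
    rw [blockDiagonal_conj]
    simp [← hXA, ← hZC]
  have hG : W' * M * W'ᵀ = (W' * U * W) * diagonal (fun i => (s i : ℂ)) * (W' * U * W)ᵀ := by
    rw [hM, hM0]
    simp only [transpose_mul, Matrix.mul_assoc]
  have hG1 : (W' * M * W'ᵀ).toBlocks₁₁ = fromBlocks (diagonal fun i => (α' i : ℂ))
      (X'ᴴ * M.toBlocks₁₁.toBlocks₁₂ * Zᴴᵀ) (Zᴴ * M.toBlocks₁₁.toBlocks₂₁ * X'ᴴᵀ)
      (diagonal fun i => (γ i : ℂ)) := by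
    rw [blockDiagonal_conj, toBlocks_fromBlocks₁₁, blockDiagonal_conj, h1, h2]
    congr 1
    · conv_lhs => rw [hXA', conjTranspose_conj_cancel hX']
    · conv_lhs => rw [hZC, conjTranspose_conj_cancel hZ]
  have hGs : ∀ i, (W' * M * W'ᵀ) (Sum.inl (Sum.inl i)) (Sum.inl (Sum.inl i)) = α' i := fun i => by
    have := congrFun (congrFun hG1 (Sum.inl i)) (Sum.inl i)
    simpa [toBlocks₁₁] using this
  have hGc : ∀ i, (W' * M * W'ᵀ) (Sum.inl (Sum.inr i)) (Sum.inl (Sum.inr i)) = γ i := fun i => by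
    have := congrFun (congrFun hG1 (Sum.inr i)) (Sum.inr i)
    simpa [toBlocks₁₁] using this
  have hUn : W' * U * W ∈ unitaryGroup _ ℂ := mul_mem (mul_mem hW' hU) hW
  -- The selection keeps exactly the diagonal entries above `t`, so the left side becomes the excess
  -- of `α'` and `γ`.
  have key := sum_diag_excess_le hUn (transpose_mem_unitaryGroup hUn) s (by
    rintro ((i | i) | i)
    · exact principalAsymmetry_nonneg _ _
    · exact principalAsymmetry_nonneg _ _
    · exact le_rfl) t
    (Sum.elim (Sum.elim (fun i => decide (t < α' i)) (fun i => decide (t < γ i))) fun _ => false)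
  rw [← hG] at key
  have hif : ∀ x : ℝ, (if t < x then x - t else 0) = max (x - t) 0 := by
    intro x
    split_ifs with hx
    · exact (max_eq_left (by linarith)).symm
    · exact (max_eq_right (by linarith)).symm
  simp only [Fintype.sum_sum_type, Sum.elim_inl, Sum.elim_inr, hGs, hGc, Complex.ofReal_re, hif,
    decide_eq_true_eq, Bool.false_eq_true, if_false, Finset.sum_const_zero, add_zero, s, Pi.zero_apply, zero_sub,
    max_eq_right (neg_nonpos.2 ht)] at key
  linarith

end Necessity

/-! ### Construction of the catalytic transformation. -/

section Sufficiency

/-- Matrix entries of a unitary performing a pair conversion. -/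
theorem PairConvertible.exists_entries {x y a w : ℝ}
    (h : PairConvertible x y a w) : ∃ b c d e : ℂ,
      b * star b + c * star c = 1 ∧ d * star d + e * star e = 1 ∧
      b * star d + c * star e = 0 ∧ d * star b + e * star c = 0 ∧
      b * x * b + c * y * c = a ∧ d * x * d + e * y * e = w := by
  have root : ∀ p : ℝ, 0 ≤ p → p ≤ 1 → ∃ u v : ℝ, u * u = p ∧ v * v = 1 - p := fun p h0 h1 =>
    ⟨√p, √(1 - p), Real.mul_self_sqrt h0, Real.mul_self_sqrt (by linarith)⟩
  rcases h with ⟨h1, h2, h3⟩ | ⟨h1, h2, h3, h4⟩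
  -- A real rotation makes `a` and `w` complementary convex combinations of `x` and `y`.
  · obtain ⟨p, hp0, hp1, hp⟩ : ∃ p : ℝ, 0 ≤ p ∧ p ≤ 1 ∧ a = p * x + (1 - p) * y := by
      rcases (h2.trans h3).eq_or_lt with h | h
      · exact ⟨0, le_rfl, zero_le_one, by linarith⟩
      · refine ⟨(a - y) / (x - y), div_nonneg (by linarith) (by linarith),
          (div_le_one (by linarith)).2 (by linarith), ?_⟩
        have : x - y ≠ 0 := by linarith
        field_simp
        ring
    obtain ⟨u, v, hu, hv⟩ := root p hp0 hp1
    refine ⟨u, v, -v, u, ?_⟩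
    simp only [star_neg, Complex.star_def, Complex.conj_ofReal]
    norm_cast
    refine ⟨by linarith, by linarith, by ring, by ring, ?_, ?_⟩
    · linear_combination x * hu + y * hv - hp
    · linear_combination x * hv + y * hu + hp - h1
  -- The factor `I` squares to `-1` under congruence: with `u² = p`, the outputs are `a = p y - (1 -
  -- p) x` and `w = p x - (1 - p) y`. Their difference is fixed and their sum is scaled by `2 p -
  -- 1`.
  · obtain ⟨p, hp0, hp1, hp⟩ : ∃ p : ℝ, 0 ≤ p ∧ p ≤ 1 ∧ a + w = (2 * p - 1) * (x + y) := by
      rcases ((add_nonneg h3 h4).trans h1).eq_or_lt with h | h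
      · exact ⟨0, le_rfl, zero_le_one, by rw [← h]; linarith⟩
      · have h5 : (a + w) / (x + y) ≤ 1 := (div_le_one h).2 h1
        have h6 : 0 ≤ (a + w) / (x + y) := div_nonneg (by linarith) h.le
        refine ⟨(1 + (a + w) / (x + y)) / 2, by linarith, by linarith, ?_⟩
        field_simp
        ring
    obtain ⟨u, v, hu, hv⟩ := root p hp0 hp1
    have huC : (u : ℂ) * u = p := by exact_mod_cast hu
    have hvC : (v : ℂ) * v = 1 - p := by exact_mod_cast hv
    have h2C : (w : ℂ) - a = x - y := by exact_mod_cast h2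
    have hpC : (a : ℂ) + w = (2 * p - 1) * (x + y) := by exact_mod_cast hp
    refine ⟨Complex.I * v, u, u, Complex.I * v, ?_⟩
    simp only [star_mul, Complex.star_def, Complex.conj_ofReal, Complex.conj_I]
    have hI := Complex.I_mul_I
    refine ⟨?_, ?_, by ring, by ring, ?_, ?_⟩
    · linear_combination huC + hvC - v * v * hI
    · linear_combination huC + hvC - v * v * hI
    · linear_combination v * v * x * hI - x * hvC + y * huC - hpC / 2 + h2C / 2
    · linear_combination v * v * y * hI - y * hvC + x * huC - hpC / 2 - h2C / 2

/-- `A → A'` with catalyst modes `κ` and no bath, in terms of unitaries. -/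
def UnitaryCatalytic {ι : Type*} [Fintype ι] [DecidableEq ι] (κ : Type*) [Fintype κ]
    [DecidableEq κ] (A A' : Matrix ι ι ℂ) : Prop :=
  ∃ (C : Matrix κ κ ℂ) (U : Matrix (ι ⊕ κ) (ι ⊕ κ) ℂ), C.IsSymm ∧ U ∈ unitaryGroup (ι ⊕ κ) ℂ ∧
    (U * fromBlocks A 0 0 C * Uᵀ).toBlocks₁₁ = A' ∧
    (U * fromBlocks A 0 0 C * Uᵀ).toBlocks₂₂ = C

variable {ι κ κ' : Type*} [Fintype ι] [DecidableEq ι] [Fintype κ] [DecidableEq κ]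
  [Fintype κ'] [DecidableEq κ']

/-- Idle catalyst modes may be added. -/
theorem UnitaryCatalytic.add_idle {A A' : Matrix ι ι ℂ} (h : UnitaryCatalytic κ A A')
    {μ : Type*} [Fintype μ] [DecidableEq μ] (e : μ ≃ κ ⊕ κ') : UnitaryCatalytic μ A A' := by
  obtain ⟨C, U, hC, hU, h1, h2⟩ := h
  let f : ι ⊕ μ ≃ (ι ⊕ κ) ⊕ κ' :=
    (Equiv.sumCongr (Equiv.refl ι) e).trans (Equiv.sumAssoc ι κ κ').symm
  let V : Matrix ((ι ⊕ κ) ⊕ κ') ((ι ⊕ κ) ⊕ κ') ℂ := fromBlocks U 0 0 1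
  have hV : V * Vᴴ = 1 := mem_unitaryGroup_iff.1 (fromBlocks_mem_unitaryGroup hU (one_mem _))
  have hin : fromBlocks A 0 0 ((fromBlocks C 0 0 (0 : Matrix κ' κ' ℂ)).submatrix e e) =
      (fromBlocks (fromBlocks A 0 0 C) 0 0 (0 : Matrix κ' κ' ℂ)).submatrix f f := by
    ext (i | i) (j | j)
    · simp [f]
    · rcases hj : e j with j' | j' <;> simp [f, hj]
    · rcases hi : e i with i' | i' <;> simp [f, hi]
    · rcases hi : e i with i' | i' <;> rcases hj : e j with j' | j' <;> simp [f, hi, hj]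
  have hout : V.submatrix f f *
      fromBlocks A 0 0 ((fromBlocks C 0 0 (0 : Matrix κ' κ' ℂ)).submatrix e e) *
      (V.submatrix f f)ᵀ =
        (fromBlocks (U * fromBlocks A 0 0 C * Uᵀ) 0 0 (0 : Matrix κ' κ' ℂ)).submatrix f f := by
    rw [hin, transpose_submatrix, submatrix_mul_equiv, submatrix_mul_equiv, blockDiagonal_conj]
    simp
  refine ⟨(fromBlocks C 0 0 0).submatrix e e, V.submatrix f f, ?_, ?_, ?_, ?_⟩
  · rw [IsSymm, transpose_submatrix, fromBlocks_transpose, hC.eq]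
    simp
  · rw [mem_unitaryGroup_iff, star_eq_conjTranspose, conjTranspose_submatrix,
      submatrix_mul_equiv, hV, submatrix_one_equiv]
  · rw [hout, ← h1]
    ext i j
    simp [f, toBlocks₁₁]
  · rw [hout]
    conv_rhs => rw [← h2]
    ext i j
    rcases hi : e i with i' | i' <;> rcases hj : e j with j' | j' <;>
      simp [f, toBlocks₂₂, hi, hj]

theorem UnitaryCatalytic.weakCatalytic {m : ℕ} {A A' : Matrix ι ι ℂ}
    (h : UnitaryCatalytic (Fin m) A A') (hA : A.IsSymm) (ν : ℝ) (k : ℕ) :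
    WeakCatalytic ν m k A A' := by
  obtain ⟨C, U, hC, hU, h1, h2⟩ := h
  refine (weakCatalytic_iff ν m k A A' hA).2 ⟨C, fromBlocks U 0 0 1, hC,
    fromBlocks_mem_unitaryGroup hU (one_mem _), ?_, ?_⟩ <;>
  · rw [blockDiagonal_conj]
    simpa

/-- Local unitaries on the system can be absorbed before and after, which reduces everything to
diagonal matrices. -/
theorem UnitaryCatalytic.conj {A A' X X' : Matrix ι ι ℂ} (h : UnitaryCatalytic κ A A')
    (hX : X ∈ unitaryGroup ι ℂ) (hX' : X' ∈ unitaryGroup ι ℂ) :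
    UnitaryCatalytic κ (X * A * Xᵀ) (X' * A' * X'ᵀ) := by
  obtain ⟨C, U, hC, hU, h1, h2⟩ := h
  have key : fromBlocks X' 0 0 1 * U * fromBlocks Xᴴ 0 0 1 * fromBlocks (X * A * Xᵀ) 0 0 C *
      (fromBlocks X' 0 0 1 * U * fromBlocks Xᴴ 0 0 1)ᵀ =
      fromBlocks X' 0 0 (1 : Matrix κ κ ℂ) * (U * fromBlocks A 0 0 C * Uᵀ) *
        (fromBlocks X' 0 0 1)ᵀ := by
    have : fromBlocks Xᴴ 0 0 1 * fromBlocks (X * A * Xᵀ) 0 0 C *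
        (fromBlocks Xᴴ 0 0 (1 : Matrix κ κ ℂ))ᵀ = fromBlocks A 0 0 C := by
      rw [blockDiagonal_conj]
      simp only [toBlocks_fromBlocks₁₁, conjTranspose_conj_cancel hX]
      simp
    rw [← this]
    simp only [transpose_mul, Matrix.mul_assoc]
  refine ⟨C, fromBlocks X' 0 0 1 * U * fromBlocks Xᴴ 0 0 1, hC,
    mul_mem (mul_mem (fromBlocks_mem_unitaryGroup hX' (one_mem _)) hU)
      (fromBlocks_mem_unitaryGroup (conjTranspose_mem_unitaryGroup hX) (one_mem _)), ?_, ?_⟩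
  · rw [key, blockDiagonal_conj, toBlocks_fromBlocks₁₁, h1]
  · rw [key, blockDiagonal_conj, toBlocks_fromBlocks₂₂, h2]
    simp

theorem unitaryCatalytic_diagonal {n : ℕ} {a s : Fin n → ℝ} (ha : Antitone a)
    (ha0 : ∀ i, 0 ≤ a i) (hs0 : ∀ i, 0 ≤ s i) (h : WeaklyMajorizedBy a s) :
    UnitaryCatalytic (Fin n) (diagonal fun i => (s i : ℂ)) (diagonal fun i => (a i : ℂ)) := by
  obtain ⟨x, y, w, σ, hp, hσ⟩ := exists_pair_conversions_of_weaklyMajorizedBy ha ha0 hs0 h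
  choose b c d e h1 h2 h3 h4 h5 h6 using fun i => (hp i).exists_entries
  -- All two-mode unitaries act in parallel; permuting the columns by `σ` performs the regrouping
  -- into pairs.
  let V : Matrix (Fin n ⊕ Fin n) (Fin n ⊕ Fin n) ℂ :=
    fromBlocks (diagonal b) (diagonal c) (diagonal d) (diagonal e)
  have hV : V ∈ unitaryGroup _ ℂ := by
    rw [mem_unitaryGroup_iff, star_eq_conjTranspose, fromBlocks_conjTranspose, fromBlocks_multiply]
    simp only [diagonal_conjTranspose, diagonal_mul_diagonal, diagonal_add, Pi.star_apply, h1, h2,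
      h3, h4, diagonal_one, diagonal_zero, fromBlocks_one]
  have hsw : fromBlocks (diagonal fun i => (s i : ℂ)) 0 0 (diagonal fun i => (w i : ℂ)) =
      diagonal ((fun i => ((Sum.elim x y i : ℝ) : ℂ)) ∘ σ.symm) := by
    rw [fromBlocks_diagonal]
    congr 1
    ext i
    rw [Function.comp_apply, hσ, Function.comp_apply, Equiv.apply_symm_apply]
    rcases i with i | i <;> rfl
  have hxy : diagonal (fun i => ((Sum.elim x y i : ℝ) : ℂ)) =
      fromBlocks (diagonal fun i => (x i : ℂ)) 0 0 (diagonal fun i => (y i : ℂ)) := by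
    rw [fromBlocks_diagonal]
    congr 1
    ext i
    rcases i with i | i <;> rfl
  refine ⟨diagonal fun i => (w i : ℂ), V.submatrix id σ.symm, isSymm_diagonal _,
    submatrix_mem_unitaryGroup hV σ.symm, ?_, ?_⟩ <;>
  · rw [hsw, submatrix_mul_diagonal_mul_transpose, hxy, fromBlocks_transpose, fromBlocks_multiply,
      fromBlocks_multiply]
    simp [diagonal_mul_diagonal, diagonal_add, h5, h6]

theorem weakCatalytic_of_weaklyMajorizedBy {n m : ℕ} (hm : n ≤ m) (k : ℕ) (ν : ℝ)
    {A A' : Matrix (Fin n) (Fin n) ℂ} (hA : A.IsSymm) (hA' : A'.IsSymm)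
    (h : WeaklyMajorizedBy (principalAsymmetry A') (principalAsymmetry A)) :
    WeakCatalytic ν m k A A' := by
  obtain ⟨X, hX, hXA⟩ := exists_takagi_principalAsymmetry A hA
  obtain ⟨X', hX', hXA'⟩ := exists_takagi_principalAsymmetry A' hA'
  have h1 := (unitaryCatalytic_diagonal (principalAsymmetry_antitone A')
    (principalAsymmetry_nonneg A') (principalAsymmetry_nonneg A) h).conj hX hX'
  rw [← hXA, ← hXA'] at h1
  exact (h1.add_idle ((finCongr (by omega : m = n + (m - n))).trans
    finSumFinEquiv.symm)).weakCatalytic hA ν k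

end Sufficiency

end GaussianThermo

theorem theorem7 (n : ℕ) (hn : 1 ≤ n) (ν : ℝ) (hν : 1 / 2 < ν)
    (A A' : Matrix (Fin n) (Fin n) ℂ) (hA : A.IsSymm) (hA' : A'.IsSymm) :
    ((∃ m : ℕ, GaussianThermo.WeakCatalytic ν m 0 A A') ↔
      GaussianThermo.WeaklyMajorizedBy
        (GaussianThermo.principalAsymmetry A') (GaussianThermo.principalAsymmetry A)) ∧
    ((∃ k : ℕ, 1 ≤ k ∧ ∃ m : ℕ, GaussianThermo.WeakCatalytic ν m k A A') ↔
      GaussianThermo.WeaklyMajorizedBy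
        (GaussianThermo.principalAsymmetry A') (GaussianThermo.principalAsymmetry A)) ∧
    (GaussianThermo.WeaklyMajorizedBy
        (GaussianThermo.principalAsymmetry A') (GaussianThermo.principalAsymmetry A) →
      GaussianThermo.WeakCatalytic ν (2 * n - 1) 0 A A' ∧
      GaussianThermo.WeakCatalytic ν n (n - 1) A A') := by
  -- All existence claims come from `n` catalyst modes without bath: `n ≤ 2 * n - 1` because `1 ≤
  -- n`, and bath modes are attached idle.
  refine ⟨⟨?_, fun h => ⟨n, ?_⟩⟩, ⟨?_, fun h => ⟨1, le_rfl, n, ?_⟩⟩, fun h => ⟨?_, ?_⟩⟩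
  · rintro ⟨m, h⟩
    exact GaussianThermo.weaklyMajorizedBy_of_weakCatalytic hA hA' h
  · exact GaussianThermo.weakCatalytic_of_weaklyMajorizedBy le_rfl 0 ν hA hA' h
  · rintro ⟨k, -, m, h⟩
    exact GaussianThermo.weaklyMajorizedBy_of_weakCatalytic hA hA' h
  · exact GaussianThermo.weakCatalytic_of_weaklyMajorizedBy le_rfl 1 ν hA hA' h
  · exact GaussianThermo.weakCatalytic_of_weaklyMajorizedBy (by omega) 0 ν hA hA' h
  · exact GaussianThermo.weakCatalytic_of_weaklyMajorizedBy le_rfl (n - 1) ν hA hA' h
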